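/- Let $\mathbb{D}=\{z\in\mathbb{C}:|z|<1\}$. For a non-constant meromorphic function $f$ on $\mathbb{D}$ and an integer $n\ge 1$ put $$S_{2,n}(f)=\frac{f''}{f'},\qquad S_{j+1,n}(f)=\bigl(S_{j,n}(f)\bigr)'-\frac1n\,\frac{f''}{f'}\,S_{j,n}(f)\quad(j\ge 2),$$ and for an integer $k\ge 1$ let $S_k(f)=S_{k+1,k}(f)$ be the generalized Schwarzian derivative of order $k$; for constant $f$ put $S_k(f)\equiv\infty$. Here $S_k(f)$ is regarded as a meromorphic function on $\mathbb{D}$ (removable singularities are removed, and $|S_k(f)|=\infty$ at poles), and $\|S_k(f)\|_\infty=\sup_{z\in\mathbb{D}}|S_k(f)(z)|\in[0,\infty]$. For every integer $k\ge 1$ and every $M\in\mathbb{R}$ there exists $N\in\mathbb{N}$, depending only on $k$ and $M$, such that for every meromorphic function $f$ on $\mathbb{D}$ with $\|S_k(f)\|_\infty\le M$, both $f$ and its derivative $f'$ have at most $N$ poles in $\mathbb{D}$, counted with multiplicity. -/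

import Mathlib

namespace GenSchwarz

noncomputable section

/-- The open unit disk. -/
def unitDisk : Set ℂ := Metric.ball 0 1

/-- `schwarzianAux f n j` is the function `S_{j+2,n}(f)`:
`S_{2,n}(f) = f''/f'` and `S_{m+1,n}(f) = S_{m,n}(f)' - (1/n) (f''/f') S_{m,n}(f)`.
For `f` meromorphic on the disk this is a meromorphic function, whose values are the
literal ones off a discrete set; only its class modulo discrete sets is used below. -/
def schwarzianAux (f : ℂ → ℂ) (n : ℕ) : ℕ → ℂ → ℂ
  | 0 => fun z => deriv (deriv f) z / deriv f z
  | j + 1 => fun z => deriv (schwarzianAux f n j) z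
      - 1 / (n : ℂ) * (deriv (deriv f) z / deriv f z) * schwarzianAux f n j z

/-- The generalized Schwarzian derivative `S_k(f) = S_{k+1,k}(f)` of a non-constant
meromorphic function, for `k ≥ 1`. -/
def genSchwarzian (k : ℕ) (f : ℂ → ℂ) : ℂ → ℂ := schwarzianAux f k (k - 1)

/-- `f` is constant on the disk, as a meromorphic function (that is, up to a discrete set). -/
def IsConstOnDisk (f : ℂ → ℂ) : Prop :=
  ∃ c : ℂ, f =ᶠ[Filter.codiscreteWithin unitDisk] fun _ => c

open Classical in
/-- The modulus at `z` of a meromorphic function `g`: it is `∞` at a pole; elsewhere it is the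
modulus of the value at `z` after removable singularities have been removed. -/
def extModulus (g : ℂ → ℂ) (z : ℂ) : EReal :=
  if meromorphicOrderAt g z < 0 then ⊤ else ((‖toMeromorphicNFAt g z z‖ : ℝ) : EReal)

/-- The supremum norm on the disk of a meromorphic function. -/
def supModulus (g : ℂ → ℂ) : EReal := ⨆ z ∈ unitDisk, extModulus g z

open Classical in
/-- The supremum norm of `S_k(f)` on the disk, where `S_k(f) ≡ ∞` for constant `f`. -/
def schwarzianSup (k : ℕ) (f : ℂ → ℂ) : EReal :=
  if IsConstOnDisk f then ⊤ else supModulus (genSchwarzian k f)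

/-- The family of all meromorphic functions `f` on the disk with `‖S_k(f)‖_∞ ≤ M`. -/
def boundedSchwarzianFamily (k : ℕ) (M : ℝ) : Set (ℂ → ℂ) :=
  {f | MeromorphicOn f unitDisk ∧ schwarzianSup k f ≤ (M : EReal)}

/-- The multiplicity of `z` as a pole of `g` (zero if `z` is not a pole). -/
def poleMult (g : ℂ → ℂ) (z : ℂ) : ℕ := (-(meromorphicOrderAt g z).untop₀).toNat

/-- The number of poles of `g` in the disk, counted with multiplicity. -/
def poleCount (g : ℂ → ℂ) : ℕ∞ :=
  ⨆ s : Finset unitDisk, ((∑ z ∈ s, poleMult g z : ℕ) : ℕ∞)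

end

end GenSchwarz

open Filter Topology GenSchwarz

/-! Write `f' = u⁻ᵏ`. The recursion then collapses to `S_k(f) = -k u⁽ᵏ⁾ / u`, so a bound on `S_k(f)`
is a linear differential inequality for `u`. Finiteness of `S_k(f)` forces every order of `f'` to be
`-k α` with `α ≥ 0` (`exists_meromorphicOrderAt_deriv_eq`), so `u` is holomorphic and its zeros are
the poles of `f'`. If `u` had `k` zeros in a convex set of diameter at most `d`, then `|u| ≤ d ^ k *
sup |u⁽ᵏ⁾|`; for small `d` the inequality turns this into a contraction and `u = 0`
(`sum_multiplicity_lt`). Finitely many small disks, chosen from `k` and `M` alone, cover the unit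
disk, and each holds fewer than `k` zeros. -/

/-! ### Non-oscillation for `‖u⁽ᵏ⁾‖ ≤ m ‖u‖`. -/

theorem analyticAt_iteratedDeriv {v : ℂ → ℂ} {z : ℂ} (hv : AnalyticAt ℂ v z) (n : ℕ) :
    AnalyticAt ℂ (iteratedDeriv n v) z := by
  rw [iteratedDeriv_eq_iterate]
  exact hv.iterated_deriv n

theorem iteratedDeriv_succ_sub_mul {v : ℂ → ℂ} {z : ℂ} (hv : AnalyticAt ℂ v z) (a : ℂ) (n : ℕ) :
    iteratedDeriv (n + 1) (fun w => (w - a) * v w) z =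
      (z - a) * iteratedDeriv (n + 1) v z + (n + 1) * iteratedDeriv n v z := by
  induction n generalizing z with
  | zero =>
    have h : HasDerivAt (fun w => (w - a) * v w) (1 * v z + (z - a) * deriv v z) z :=
      ((hasDerivAt_id z).sub_const a).mul hv.differentiableAt.hasDerivAt
    simp only [zero_add, iteratedDeriv_one, iteratedDeriv_zero, h.deriv]
    push_cast
    ring
  | succ n ih =>
    have he : iteratedDeriv (n + 1) (fun w => (w - a) * v w) =ᶠ[𝓝 z] fun w =>
        (w - a) * iteratedDeriv (n + 1) v w + (n + 1) * iteratedDeriv n v w := by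
      filter_upwards [hv.eventually_analyticAt] with w hw using ih hw
    rw [iteratedDeriv_succ, he.deriv_eq]
    have h1 : HasDerivAt (iteratedDeriv (n + 1) v) (iteratedDeriv (n + 1 + 1) v z) z := by
      rw [iteratedDeriv_succ (n := n + 1)]
      exact (analyticAt_iteratedDeriv hv (n + 1)).differentiableAt.hasDerivAt
    have h0 : HasDerivAt (iteratedDeriv n v) (iteratedDeriv (n + 1) v z) z := by
      rw [iteratedDeriv_succ (n := n)]
      exact (analyticAt_iteratedDeriv hv n).differentiableAt.hasDerivAt
    have h : HasDerivAt (fun w => (w - a) * iteratedDeriv (n + 1) v w +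
        (n + 1) * iteratedDeriv n v w) (1 * iteratedDeriv (n + 1) v z +
        (z - a) * iteratedDeriv (n + 1 + 1) v z + (n + 1) * iteratedDeriv (n + 1) v z) z :=
      (((hasDerivAt_id z).sub_const a).mul h1).add (h0.const_mul _)
    rw [h.deriv]
    push_cast
    ring

/-- Dividing by a linear factor lowers the order of a derivative bound by one. -/
theorem norm_iteratedDeriv_le_of_sub_mul {K : Set ℂ} (hKo : IsOpen K) (hKc : Convex ℝ K)
    {v : ℂ → ℂ} (hv : AnalyticOnNhd ℂ v K) {a : ℂ} (ha : a ∈ K) {n : ℕ} {C : ℝ}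
    (hC : ∀ z ∈ K, ‖iteratedDeriv (n + 1) (fun w => (w - a) * v w) z‖ ≤ C) :
    ∀ z ∈ K, ‖iteratedDeriv n v z‖ ≤ C := by
  have key : ∀ z ∈ K, z ≠ a → ‖iteratedDeriv n v z‖ ≤ C := by
    intro z hz hza
    have hpos : 0 < ‖z - a‖ := norm_pos_iff.2 (sub_ne_zero.2 hza)
    have hC0 : 0 ≤ C := (norm_nonneg _).trans (hC z hz)
    -- By Leibniz, `(w - a)ⁿ ((w - a) v)⁽ⁿ⁺¹⁾` is the derivative of `(w - a)ⁿ⁺¹ v⁽ⁿ⁾`, which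
    -- vanishes at `a`. The closed ball gives `‖w - a‖ ≤ ‖z - a‖`, so the powers cancel and `C`
    -- survives without loss.
    have hd : ∀ w ∈ K ∩ Metric.closedBall a ‖z - a‖,
        HasDerivWithinAt (fun w => (w - a) ^ (n + 1) * iteratedDeriv n v w)
          ((w - a) ^ n * iteratedDeriv (n + 1) (fun w => (w - a) * v w) w)
          (K ∩ Metric.closedBall a ‖z - a‖) w := by
      intro w hw
      rw [iteratedDeriv_succ_sub_mul (hv w hw.1)]
      have h0 : HasDerivAt (iteratedDeriv n v) (iteratedDeriv (n + 1) v w) w := by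
        rw [iteratedDeriv_succ (n := n)]
        exact (analyticAt_iteratedDeriv (hv w hw.1) n).differentiableAt.hasDerivAt
      have h := (((hasDerivAt_id w).sub_const a).pow (n + 1)).mul h0
      refine (h.congr_deriv ?_).hasDerivWithinAt
      simp
      ring
    have hb : ∀ w ∈ K ∩ Metric.closedBall a ‖z - a‖,
        ‖(w - a) ^ n * iteratedDeriv (n + 1) (fun w => (w - a) * v w) w‖ ≤ ‖z - a‖ ^ n * C := by
      intro w hw
      rw [norm_mul, norm_pow]
      have h1 : ‖w - a‖ ≤ ‖z - a‖ := by simpa [dist_eq_norm] using hw.2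
      have h2 := hC w hw.1
      gcongr
    have hm := (hKc.inter (convex_closedBall a ‖z - a‖)).norm_image_sub_le_of_norm_hasDerivWithin_le
      hd hb (x := a) (y := z) ⟨ha, by simp⟩ ⟨hz, by simp [dist_eq_norm]⟩
    simp only [sub_self, ne_eq, Nat.add_eq_zero_iff, one_ne_zero, and_false, not_false_eq_true,
      zero_pow, zero_mul, sub_zero, norm_mul, norm_pow] at hm
    have hp : 0 < ‖z - a‖ ^ (n + 1) := by positivity
    refine le_of_mul_le_mul_left (hm.trans_eq ?_) hp
    ring
  intro z hz
  by_cases hza : z = a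
  · subst hza
    have ht : Tendsto (fun w => ‖iteratedDeriv n v w‖) (𝓝[≠] z) (𝓝 ‖iteratedDeriv n v z‖) :=
      (analyticAt_iteratedDeriv (hv z hz) n).continuousAt.norm.tendsto.mono_left nhdsWithin_le_nhds
    refine le_of_tendsto ht ?_
    filter_upwards [nhdsWithin_le_nhds (hKo.mem_nhds hz), self_mem_nhdsWithin] with w hw hwz
    exact key w hw hwz
  · exact key z hz hza

theorem analyticAt_multiset_prod_sub (S : Multiset ℂ) (z : ℂ) :
    AnalyticAt ℂ (fun w => (S.map fun a => w - a).prod) z := by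
  induction S using Multiset.induction with
  | empty => simpa using analyticAt_const
  | cons a S ih =>
    simp only [Multiset.map_cons, Multiset.prod_cons]
    exact (analyticAt_id.sub analyticAt_const).mul ih

/-- A function with `n` zeros in a convex set is controlled there by its `n`-th derivative. -/
theorem norm_le_of_multiset_zeros {K : Set ℂ} (hKo : IsOpen K) (hKc : Convex ℝ K) {d : ℝ}
    (hd : ∀ z ∈ K, ∀ w ∈ K, ‖z - w‖ ≤ d) {v : ℂ → ℂ} (hv : AnalyticOnNhd ℂ v K)
    (S : Multiset ℂ) (hS : ∀ a ∈ S, a ∈ K) {C : ℝ}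
    (hC : ∀ z ∈ K,
      ‖iteratedDeriv S.card (fun w => (S.map fun a => w - a).prod * v w) z‖ ≤ C) :
    ∀ z ∈ K, ‖(S.map fun a => z - a).prod * v z‖ ≤ d ^ S.card * C := by
  induction S using Multiset.induction with
  | empty => simpa using hC
  | cons a S ih =>
    intro z hz
    have haK : a ∈ K := hS a (Multiset.mem_cons_self a S)
    have hd0 : 0 ≤ d := (norm_nonneg _).trans (hd a haK a haK)
    have hfun : (fun w => ((a ::ₘ S).map fun a => w - a).prod * v w) =
        fun w => (w - a) * ((S.map fun a => w - a).prod * v w) := by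
      funext w
      simp [mul_assoc]
    rw [Multiset.card_cons, hfun] at hC
    have h1 := ih (fun b hb => hS b (Multiset.mem_cons_of_mem hb))
      (norm_iteratedDeriv_le_of_sub_mul hKo hKc
        (fun w hw => (analyticAt_multiset_prod_sub S w).mul (hv w hw)) haK hC) z hz
    rw [Multiset.map_cons, Multiset.prod_cons, mul_assoc, norm_mul, Multiset.card_cons, pow_succ',
      mul_assoc]
    exact mul_le_mul (hd z hz a haK) h1 (norm_nonneg _) hd0

/-- Non-oscillation: on a small convex set, a nontrivial solution of `‖u⁽ᵏ⁾‖ ≤ m ‖u‖` has fewer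
than `k` zeros. -/
theorem sum_multiplicity_lt {K : Set ℂ} (hKo : IsOpen K) (hKc : Convex ℝ K) {d : ℝ}
    (hd : ∀ z ∈ K, ∀ w ∈ K, ‖z - w‖ ≤ d) {k : ℕ} (hk : 1 ≤ k) {m B : ℝ} (hm : 0 ≤ m)
    (hdm : d ^ k * m < 1)
    {T s : Finset ℂ} (hsT : s ⊆ T) (hsK : ∀ a ∈ s, a ∈ K) (α : ℂ → ℕ) {g u : ℂ → ℂ}
    (hg : AnalyticOnNhd ℂ g K) (hg0 : ∀ z ∈ K, g z ≠ 0)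
    (hu : u = fun z => (∏ a ∈ T, (z - a) ^ α a) * g z) (hB : ∀ z ∈ K, ‖u z‖ ≤ B)
    (hode : ∀ z ∈ K, ‖iteratedDeriv k u z‖ ≤ m * ‖u z‖) :
    ∑ a ∈ s, α a < k := by
  classical
  by_contra! hlt
  let R : Multiset ℂ := ∑ a ∈ s, Multiset.replicate (α a) a
  have hRcard : R.card = ∑ a ∈ s, α a := by simp [R]
  have hRprod : ∀ z, (R.map fun a => z - a).prod = ∏ a ∈ s, (z - a) ^ α a := by
    intro z
    simp only [R]
    clear * -
    induction s using Finset.induction with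
    | empty => simp
    | insert a s ha ih => simp [Finset.sum_insert ha, Finset.prod_insert ha, ih]
  -- Exactly `k` zeros are kept, to match the order of the inequality; the surplus ones are absorbed
  -- into `v`.
  obtain ⟨S, hSR, hScard⟩ : ∃ S ≤ R, S.card = k := by
    have h : 0 < (Multiset.powersetCard k R).card := by
      rw [Multiset.card_powersetCard, hRcard]
      exact Nat.choose_pos hlt
    obtain ⟨S, hS⟩ := Multiset.card_pos_iff_exists_mem.1 h
    exact ⟨S, Multiset.mem_powersetCard.1 hS⟩
  obtain ⟨Q, hQ⟩ := Multiset.le_iff_exists_add.1 hSR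
  have hSK : ∀ a ∈ S, a ∈ K := by
    intro a ha
    have : a ∈ R := Multiset.mem_of_le hSR ha
    simp only [R, Multiset.mem_sum] at this
    obtain ⟨b, hb, hab⟩ := this
    rw [Multiset.eq_of_mem_replicate hab]
    exact hsK b hb
  let v : ℂ → ℂ := fun z => (Q.map fun a => z - a).prod * ((∏ a ∈ T \ s, (z - a) ^ α a) * g z)
  have hv : AnalyticOnNhd ℂ v K := fun z hz =>
    (analyticAt_multiset_prod_sub Q z).mul
      ((Finset.analyticAt_fun_prod _ fun a _ => by fun_prop).mul (hg z hz))
  have huv : u = fun z => (S.map fun a => z - a).prod * v z := by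
    rw [hu]
    funext z
    rw [← Finset.prod_sdiff hsT, ← hRprod z, hQ, Multiset.map_add, Multiset.prod_add]
    simp only [v]
    ring
  -- Any bound on `u` improves by the factor `d ^ k * m < 1`; iterating from `B` forces `u = 0` on
  -- `K`.
  have step : ∀ C : ℝ, (∀ z ∈ K, ‖u z‖ ≤ C) → ∀ z ∈ K, ‖u z‖ ≤ (d ^ k * m) * C := by
    intro C hC z hz
    have h := norm_le_of_multiset_zeros hKo hKc hd hv S hSK (C := m * C) (by
      rw [hScard, ← huv]
      intro w hw
      exact (hode w hw).trans (mul_le_mul_of_nonneg_left (hC w hw) hm)) z hz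
    rw [hScard] at h
    rw [mul_assoc]
    simpa [huv] using h
  have hne : S ≠ 0 := by
    intro h
    rw [h] at hScard
    simp at hScard
    omega
  obtain ⟨a₀, ha₀⟩ := Multiset.exists_mem_of_ne_zero hne
  have haK := hSK a₀ ha₀
  have hd0 : 0 ≤ d := (norm_nonneg _).trans (hd a₀ haK a₀ haK)
  have hq0 : 0 ≤ d ^ k * m := by positivity
  have hiter : ∀ n : ℕ, ∀ z ∈ K, ‖u z‖ ≤ (d ^ k * m) ^ n * B := by
    intro n
    induction n with
    | zero => simpa using hB
    | succ n ih =>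
      intro z hz
      rw [pow_succ', mul_assoc]
      exact step _ ih z hz
  have hzero : ∀ z ∈ K, u z = 0 := by
    intro z hz
    have ht : Tendsto (fun n : ℕ => (d ^ k * m) ^ n * B) atTop (𝓝 (0 * B)) :=
      (tendsto_pow_atTop_nhds_zero_of_lt_one hq0 hdm).mul_const B
    rw [zero_mul] at ht
    exact norm_le_zero_iff.1 (ge_of_tendsto' ht fun n => hiter n z hz)
  have hinf : (K \ T).Nonempty := by
    have hKinf : K.Infinite := infinite_of_mem_nhds a₀ (hKo.mem_nhds haK)
    exact (hKinf.sdiff T.finite_toSet).nonempty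
  obtain ⟨z, hzK, hzT⟩ := hinf
  have h0 := hzero z hzK
  rw [hu] at h0
  refine mul_ne_zero (Finset.prod_ne_zero_iff.2 fun a ha => pow_ne_zero _ (sub_ne_zero.2 ?_))
    (hg0 z hzK) h0
  rintro rfl
  exact hzT ha

/-! ### Local form of the Schwarzian derivatives. -/

/-- Behaviour of `S_{j+2,n}(f)` at a point where `f'` has order `m`. -/
theorem schwarzianAux_eventuallyEq_zpow {f h : ℂ → ℂ} {a : ℂ} {m : ℤ} (hh : AnalyticAt ℂ h a)
    (h0 : h a ≠ 0) (hf : deriv f =ᶠ[𝓝[≠] a] fun z => (z - a) ^ m * h z) (n j : ℕ) :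
    ∃ φ : ℂ → ℂ, AnalyticAt ℂ φ a ∧
      φ a = m * ∏ i ∈ Finset.range j, (-((i : ℂ) + 1) - m / n) ∧
      schwarzianAux f n j =ᶠ[𝓝[≠] a] fun z => φ z * (z - a) ^ (-((j : ℤ) + 1)) := by
  have hmem : ∀ᶠ z in 𝓝[≠] a, z - a ≠ 0 := by
    filter_upwards [self_mem_nhdsWithin] with z hz using sub_ne_zero.2 hz
  have hzpow : ∀ (p : ℤ) (z : ℂ), z - a ≠ 0 →
      HasDerivAt (fun w => (w - a) ^ p) (p * (z - a) ^ (p - 1)) z := by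
    intro p z hz
    have := (hasDerivAt_zpow p (z - a) (Or.inl hz)).comp z ((hasDerivAt_id z).sub_const a)
    simpa [Function.comp_def] using this
  have hpre : ∀ᶠ z in 𝓝[≠] a, deriv (deriv f) z / deriv f z =
      ((m : ℂ) + (z - a) * (deriv h z / h z)) * (z - a) ^ (-1 : ℤ) := by
    filter_upwards [hmem, hf, hf.nhdsNE_deriv,
      hh.eventually_analyticAt.filter_mono nhdsWithin_le_nhds,
      (hh.continuousAt.eventually_ne h0).filter_mono nhdsWithin_le_nhds] with z hz h1 h2 h3 h4
    have hd := (hzpow m z hz).mul h3.differentiableAt.hasDerivAt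
    have hd' : deriv (fun z => (z - a) ^ m * h z) z =
        m * (z - a) ^ (m - 1) * h z + (z - a) ^ m * deriv h z := hd.deriv
    rw [h1, h2, hd', zpow_sub_one₀ hz, zpow_neg_one]
    have : (z - a) ^ m ≠ 0 := zpow_ne_zero _ hz
    field_simp
  have hφ₀ : AnalyticAt ℂ (fun z => (m : ℂ) + (z - a) * (deriv h z / h z)) a := by
    have := hh.deriv.fun_div hh h0
    fun_prop
  induction j with
  | zero => exact ⟨_, hφ₀, by simp, by simpa [schwarzianAux, EventuallyEq] using hpre⟩
  | succ j ih =>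
    obtain ⟨φ, hφ, hφa, he⟩ := ih
    -- At `a`, differentiating the power contributes `-(j + 1)` and the pole `m / (z - a)` of
    -- `f''/f'` contributes `-m / n`: the next factor of the product.
    refine ⟨fun z => (z - a) * deriv φ z - ((j : ℂ) + 1) * φ z -
      1 / (n : ℂ) * ((m : ℂ) + (z - a) * (deriv h z / h z)) * φ z, ?_, ?_, ?_⟩
    · have := hφ.deriv
      fun_prop
    · rw [Finset.prod_range_succ, ← mul_assoc, ← hφa]
      simp
      ring
    · filter_upwards [hmem, hpre, he, he.nhdsNE_deriv,
        hφ.eventually_analyticAt.filter_mono nhdsWithin_le_nhds] with z hz h1 h2 h3 h4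
      have hd := (h4.differentiableAt.hasDerivAt).mul (hzpow (-((j : ℤ) + 1)) z hz)
      have hd' : deriv (fun z => φ z * (z - a) ^ (-((j : ℤ) + 1))) z = _ := hd.deriv
      simp only [schwarzianAux]
      rw [h1, h2, h3, hd']
      have e1 : (z - a) ^ (-((j : ℤ) + 1)) = (z - a) ^ (-(((j + 1 : ℕ) : ℤ) + 1)) * (z - a) := by
        rw [← zpow_add_one₀ hz]
        congr 1
      have e2 : -((j : ℤ) + 1) - 1 = -(((j + 1 : ℕ) : ℤ) + 1) := by
        push_cast
        ring
      rw [e2, e1, zpow_neg_one]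
      push_cast
      field_simp
      ring

/-- If `S_k(f)` has no pole at `a`, the order of `f'` at `a` is `-k α` for some `α ≥ 0`. -/
theorem exists_meromorphicOrderAt_deriv_eq {f : ℂ → ℂ} {a : ℂ} {k : ℕ} (hk : 1 ≤ k)
    (hf : MeromorphicAt (deriv f) a) (htop : meromorphicOrderAt (deriv f) a ≠ ⊤)
    (hS : 0 ≤ meromorphicOrderAt (genSchwarzian k f) a) :
    ∃ α : ℕ, meromorphicOrderAt (deriv f) a = ((-(k * α : ℕ) : ℤ) : WithTop ℤ) := by
  obtain ⟨h, hh, h0, he⟩ := (meromorphicOrderAt_ne_top_iff hf).1 htop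
  set m := (meromorphicOrderAt (deriv f) a).untop₀ with hm
  obtain ⟨φ, hφ, hφa, hφe⟩ := schwarzianAux_eventuallyEq_zpow hh h0 (by simpa using he) k (k - 1)
  -- Otherwise `S_k(f)` would have a genuine pole of order `k`. The roots of the resulting equation
  -- in `m` are `0` and `-k (i + 1)`.
  have hφ0 : φ a = 0 := by
    by_contra hne
    have : meromorphicOrderAt (genSchwarzian k f) a =
        ((-(((k - 1 : ℕ) : ℤ) + 1) : ℤ) : WithTop ℤ) := by
      rw [genSchwarzian, meromorphicOrderAt_congr hφe]
      refine (meromorphicOrderAt_eq_int_iff ?_).2 ⟨φ, hφ, hne, ?_⟩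
      · exact hφ.meromorphicAt.fun_mul (by fun_prop)
      · exact Eventually.of_forall fun z => by simp [mul_comm]
    rw [this] at hS
    have : (0 : ℤ) ≤ -(((k - 1 : ℕ) : ℤ) + 1) := by exact_mod_cast hS
    omega
  have hk0 : (k : ℂ) ≠ 0 := by
    exact_mod_cast (by omega : k ≠ 0)
  have hord : meromorphicOrderAt (deriv f) a = ((m : ℤ) : WithTop ℤ) :=
    (WithTop.coe_untop₀_of_ne_top htop).symm
  rw [hφa, mul_eq_zero, Finset.prod_eq_zero_iff] at hφ0
  rcases hφ0 with hm0 | ⟨i, -, hi⟩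
  · have : m = 0 := by exact_mod_cast hm0
    exact ⟨0, by rw [hord, this]; simp⟩
  · refine ⟨i + 1, ?_⟩
    have : (m : ℂ) = ((-(k * (i + 1) : ℕ) : ℤ) : ℂ) := by
      field_simp at hi
      push_cast
      linear_combination -hi
    rw [hord, Int.cast_injective this]

/-- Where `f' = u⁻ᵏ`, the Schwarzian derivatives are quotients `-k u⁽ʲ⁾ / u`. -/
theorem schwarzianAux_eventuallyEq_of_deriv_eq_inv_pow {f u : ℂ → ℂ} {z : ℂ} {k : ℕ} (hk : 1 ≤ k)
    (hu : AnalyticAt ℂ u z) (hu0 : u z ≠ 0) (hf : deriv f =ᶠ[𝓝 z] fun w => (u w ^ k)⁻¹) (j : ℕ) :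
    schwarzianAux f k j =ᶠ[𝓝 z] fun w => -k * iteratedDeriv (j + 1) u w / u w := by
  have hk0 : (k : ℂ) ≠ 0 := by
    exact_mod_cast (by omega : k ≠ 0)
  have hpre : ∀ᶠ w in 𝓝 z, deriv (deriv f) w / deriv f w = -k * deriv u w / u w := by
    filter_upwards [hf, hf.deriv, hu.eventually_analyticAt, hu.continuousAt.eventually_ne hu0]
      with w h1 h2 h3 h4
    have hd := (h3.differentiableAt.hasDerivAt.pow k).inv (pow_ne_zero k h4)
    have hd' : deriv (fun w => (u w ^ k)⁻¹) w = _ := hd.deriv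
    rw [h1, h2, hd']
    obtain ⟨l, rfl⟩ : ∃ l, k = l + 1 := ⟨k - 1, by omega⟩
    simp only [Pi.pow_apply, Nat.add_sub_cancel]
    field_simp
    ring
  -- The correction term equals `(u'/u) S_j`, which cancels the part of `S_j'` coming from the
  -- denominator `u`.
  induction j with
  | zero => simpa [schwarzianAux, iteratedDeriv_one, EventuallyEq] using hpre
  | succ j ih =>
    filter_upwards [hpre, ih, ih.deriv, hu.eventually_analyticAt,
      hu.continuousAt.eventually_ne hu0] with w h1 h2 h3 h4 h5
    have hd := (((analyticAt_iteratedDeriv h4 (j + 1)).differentiableAt.hasDerivAt).const_mul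
      (-(k : ℂ))).div h4.differentiableAt.hasDerivAt h5
    have hd' : deriv (fun w => -(k : ℂ) * iteratedDeriv (j + 1) u w / u w) w = _ := hd.deriv
    simp only [schwarzianAux]
    rw [h1, h2, h3, hd', iteratedDeriv_succ (n := j + 1)]
    field_simp
    ring

/-! ### Holomorphic roots, constancy, and poles of a derivative. -/

/-- A primitive `F` of `h'/h` is a logarithm of `h` on the disk; the root is `exp (-F / k)`. -/
theorem exists_inv_root_of_ne_zero {ρ : ℝ} {h : ℂ → ℂ} (hρ : 0 < ρ)
    (hh : AnalyticOnNhd ℂ h (Metric.ball 0 ρ)) (h0 : ∀ z ∈ Metric.ball 0 ρ, h z ≠ 0) {k : ℕ}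
    (hk : 1 ≤ k) :
    ∃ g : ℂ → ℂ, AnalyticOnNhd ℂ g (Metric.ball 0 ρ) ∧ (∀ z ∈ Metric.ball 0 ρ, g z ≠ 0) ∧
      ∀ z ∈ Metric.ball 0 ρ, g z ^ k = (h z)⁻¹ := by
  have hk0 : (k : ℂ) ≠ 0 := by
    exact_mod_cast (by omega : k ≠ 0)
  have h0mem : (0 : ℂ) ∈ Metric.ball (0 : ℂ) ρ := Metric.mem_ball_self hρ
  have hdiff : DifferentiableOn ℂ (fun z => deriv h z / h z) (Metric.ball 0 ρ) := fun z hz =>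
    ((hh z hz).deriv.fun_div (hh z hz) (h0 z hz)).differentiableAt.differentiableWithinAt
  obtain ⟨F, hF0, hF⟩ := hdiff.isExactOn_ball.with_val_at 0 (Complex.log (h 0))
  have hFan : AnalyticOnNhd ℂ F (Metric.ball 0 ρ) :=
    DifferentiableOn.analyticOnNhd
      (fun z hz => (hF z hz).differentiableAt.differentiableWithinAt) Metric.isOpen_ball
  have hconst : ∀ z ∈ Metric.ball (0 : ℂ) ρ, h z * Complex.exp (-F z) = 1 := by
    intro z hz
    have hd : ∀ w ∈ Metric.ball (0 : ℂ) ρ, HasDerivWithinAt (fun w => h w * Complex.exp (-F w))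
        ((fun _ => 0 : ℂ → ℂ) w) (Metric.ball 0 ρ) w := by
      intro w hw
      have h1 := (hh w hw).differentiableAt.hasDerivAt.mul (hF w hw).neg.cexp
      refine (h1.congr_deriv ?_).hasDerivWithinAt
      have := h0 w hw
      simp only [Pi.neg_apply]
      field_simp
      ring
    have := (convex_ball (0 : ℂ) ρ).norm_image_sub_le_of_norm_hasDerivWithin_le hd
      (C := 0) (by simp) h0mem hz
    rw [zero_mul, norm_le_zero_iff, sub_eq_zero] at this
    rw [this, hF0, Complex.exp_neg, Complex.exp_log (h0 0 h0mem), mul_inv_cancel₀ (h0 0 h0mem)]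
  refine ⟨fun z => Complex.exp (-F z / k), fun z hz => ?_, fun z _ => Complex.exp_ne_zero _, ?_⟩
  · have := hFan z hz
    fun_prop (disch := assumption)
  · intro z hz
    rw [← Complex.exp_nat_mul, mul_div_cancel₀ _ hk0]
    exact eq_inv_of_mul_eq_one_right (hconst z hz)

theorem exists_meromorphicOrderAt_sub_eq_top_of_deriv {f : ℂ → ℂ} {a : ℂ} (hf : MeromorphicAt f a)
    (htop : meromorphicOrderAt (deriv f) a = ⊤) :
    ∃ c : ℂ, meromorphicOrderAt (fun z => f z - c) a = ⊤ := by
  by_cases hft : meromorphicOrderAt f a = ⊤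
  · exact ⟨0, by simpa using hft⟩
  obtain ⟨n, hn⟩ := WithTop.ne_top_iff_exists.1 hft
  by_cases hn0 : n = 0
  · subst hn0
    obtain ⟨h, hh, -, he⟩ := (meromorphicOrderAt_eq_int_iff hf).1 hn.symm
    have he' : f =ᶠ[𝓝[≠] a] h := by
      filter_upwards [he] with z hz using by simpa using hz
    have hd0 : ∀ᶠ z in 𝓝[≠] a, deriv h z = 0 := by
      filter_upwards [he'.nhdsNE_deriv, meromorphicOrderAt_eq_top_iff.1 htop] with z h1 h2
      rw [← h1, h2]
    have hd1 : ∀ᶠ z in 𝓝 a, deriv h z = 0 :=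
      (hh.deriv.frequently_zero_iff_eventually_zero).1 hd0.frequently
    obtain ⟨r, hr, hball⟩ := Metric.eventually_nhds_iff_ball.1 (hd1.and hh.eventually_analyticAt)
    refine ⟨h a, meromorphicOrderAt_eq_top_iff.2 ?_⟩
    filter_upwards [he', nhdsWithin_le_nhds (Metric.ball_mem_nhds a hr)] with z h1 h2
    have := (convex_ball a r).norm_image_sub_le_of_norm_deriv_le (f := h) (C := 0)
      (fun w hw => (hball w hw).2.differentiableAt) (fun w hw => by simp [(hball w hw).1])
      (Metric.mem_ball_self hr) h2
    rw [zero_mul, norm_le_zero_iff] at this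
    rw [h1, this]
  · have := meromorphicOrderAt_deriv_eq_sub_one (Int.cast_ne_zero.2 hn0) hn.symm
    rw [this] at htop
    exact absurd htop (WithTop.coe_ne_top)

/-- Local constancy near one point spreads over the connected disk by the identity theorem. -/
theorem meromorphicOrderAt_deriv_ne_top_of_not_isConst {f : ℂ → ℂ}
    (hf : MeromorphicOn f unitDisk) (hc : ¬ IsConstOnDisk f) {a : ℂ} (ha : a ∈ unitDisk) :
    meromorphicOrderAt (deriv f) a ≠ ⊤ := by
  intro htop
  obtain ⟨c, hfc⟩ := exists_meromorphicOrderAt_sub_eq_top_of_deriv (hf a ha) htop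
  refine hc ⟨c, ?_⟩
  have hm : MeromorphicOn (fun z => f z - c) unitDisk := fun z hz =>
    (hf z hz).fun_sub (MeromorphicAt.const c z)
  refine mem_codiscreteWithin_iff_forall_mem_nhdsNE.2 fun z hz => ?_
  have hz' : meromorphicOrderAt (fun z => f z - c) z = ⊤ := by
    by_contra hne
    exact hm.meromorphicOrderAt_ne_top_of_isPreconnected
      (convex_ball (0 : ℂ) 1).isPreconnected hz ha hne hfc
  filter_upwards [meromorphicOrderAt_eq_top_iff.1 hz'] with w hw
  exact Or.inl (sub_eq_zero.1 hw)

theorem poleMult_le_poleMult_deriv {f : ℂ → ℂ} {a : ℂ} : poleMult f a ≤ poleMult (deriv f) a := by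
  unfold poleMult
  by_cases h : 0 ≤ (meromorphicOrderAt f a).untop₀
  · rw [Int.toNat_of_nonpos (by omega)]
    exact Nat.zero_le _
  · have hft : meromorphicOrderAt f a ≠ ⊤ := by
      intro h1
      simp [h1] at h
    obtain ⟨n, hn⟩ := WithTop.ne_top_iff_exists.1 hft
    rw [← hn, WithTop.untop₀_coe] at h
    have := meromorphicOrderAt_deriv_eq_sub_one (Int.cast_ne_zero.2 (by omega : n ≠ 0)) hn.symm
    rw [this, ← hn, WithTop.untop₀_coe, WithTop.untop₀_coe]
    omega

/-! ### The function `u` and the count of poles. -/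

/-- On a disk compactly inside the unit disk, `f' = u⁻ᵏ` for a holomorphic `u` that satisfies a
linear differential inequality of order `k`. -/
theorem exists_analytic_inv_root_deriv {f : ℂ → ℂ} {k : ℕ} (hk : 1 ≤ k) {M : ℝ}
    (hf : MeromorphicOn f unitDisk) (htop : ∀ a ∈ unitDisk, meromorphicOrderAt (deriv f) a ≠ ⊤)
    (hS : ∀ a ∈ unitDisk, extModulus (genSchwarzian k f) a ≤ M) {ρ : ℝ} (hρ : 0 < ρ) (hρ1 : ρ < 1)
    (s : Finset ℂ) :
    ∃ (α : ℂ → ℕ) (T : Finset ℂ) (g u : ℂ → ℂ), s ⊆ T ∧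
      (∀ a ∈ Metric.ball 0 ρ,
        meromorphicOrderAt (deriv f) a = ((-(k * α a : ℕ) : ℤ) : WithTop ℤ)) ∧
      AnalyticOnNhd ℂ g (Metric.ball 0 ρ) ∧ (∀ z ∈ Metric.ball 0 ρ, g z ≠ 0) ∧
      (u = fun z => (∏ a ∈ T, (z - a) ^ α a) * g z) ∧
      ∀ z ∈ Metric.ball 0 ρ, ‖iteratedDeriv k u z‖ ≤ |M| * ‖u z‖ := by
  classical
  have hsub : Metric.closedBall (0 : ℂ) ρ ⊆ unitDisk := Metric.closedBall_subset_ball hρ1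
  have hord0 : ∀ a ∈ unitDisk, 0 ≤ meromorphicOrderAt (genSchwarzian k f) a := by
    intro a ha
    by_contra! hlt
    have := hS a ha
    rw [extModulus, if_pos hlt, top_le_iff] at this
    exact EReal.coe_ne_top M this
  have hex : ∀ a : ℂ, ∃ n : ℕ, a ∈ unitDisk →
      meromorphicOrderAt (deriv f) a = ((-(k * n : ℕ) : ℤ) : WithTop ℤ) := by
    intro a
    by_cases ha : a ∈ unitDisk
    · obtain ⟨n, hn⟩ := exists_meromorphicOrderAt_deriv_eq hk (hf a ha).deriv (htop a ha)
        (hord0 a ha)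
      exact ⟨n, fun _ => hn⟩
    · exact ⟨0, fun h => absurd h ha⟩
  choose α hα using hex
  have hmer : MeromorphicOn (deriv f) (Metric.closedBall 0 ρ) := fun z hz => (hf z (hsub hz)).deriv
  set D := MeromorphicOn.divisor (deriv f) (Metric.closedBall 0 ρ) with hD
  have hfin : D.support.Finite := D.finiteSupport (isCompact_closedBall 0 ρ)
  obtain ⟨h, hh, hh0, he⟩ := hmer.extract_zeros_poles
    (fun z => htop z (hsub z.2)) hfin
  have hDα : ∀ a ∈ Metric.closedBall (0 : ℂ) ρ, D a = -(k * α a : ℕ) := by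
    intro a ha
    rw [hD, MeromorphicOn.divisor_apply hmer ha, hα a (hsub ha), WithTop.untop₀_coe]
  obtain ⟨g, hg, hg0, hgk⟩ := exists_inv_root_of_ne_zero hρ
    (hh.mono Metric.ball_subset_closedBall)
    (fun z hz => hh0 ⟨z, Metric.ball_subset_closedBall hz⟩) hk
  -- Exponents vanish off the closed disk, and also inside it off the support of the divisor, so
  -- enlarging the product to include `s` changes nothing.
  set α' : ℂ → ℕ := fun a => if a ∈ Metric.closedBall (0 : ℂ) ρ then α a else 0 with hα'
  have hDα' : ∀ a, D a = -(k * α' a : ℕ) := by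
    intro a
    by_cases ha : a ∈ Metric.closedBall (0 : ℂ) ρ
    · simp only [hα', if_pos ha, hDα a ha]
    · simp only [hα', if_neg ha, mul_zero, Nat.cast_zero, neg_zero]
      exact D.apply_eq_zero_of_notMem ha
  set T := hfin.toFinset ∪ s with hT
  set u : ℂ → ℂ := fun z => (∏ a ∈ T, (z - a) ^ α' a) * g z with hu
  have huan : AnalyticOnNhd ℂ u (Metric.ball 0 ρ) := fun z hz =>
    (Finset.analyticAt_fun_prod _ fun a _ => by fun_prop).mul (hg z hz)
  have hu0 : ∀ z ∈ Metric.ball 0 ρ, z ∉ T → u z ≠ 0 := by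
    intro z hz hzT
    refine mul_ne_zero (Finset.prod_ne_zero_iff.2 fun a ha => pow_ne_zero _ (sub_ne_zero.2 ?_))
      (hg0 z hz)
    rintro rfl
    exact hzT ha
  refine ⟨α', T, g, u, Finset.subset_union_right, ?_, hg, hg0, rfl, ?_⟩
  · intro a ha
    have ha' := Metric.ball_subset_closedBall ha
    simp only [hα', if_pos ha']
    exact hα a (hsub ha')
  intro a ha
  -- The factorization of `f'` holds only off a discrete set, so the inequality is proved near `a`
  -- and reaches `a` by continuity.
  have hgen : ∀ᶠ z in 𝓝[≠] a, u z ≠ 0 ∧ deriv f z = (u z ^ k)⁻¹ ∧ z ∈ Metric.ball 0 ρ := by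
    have hTc : ∀ᶠ z in 𝓝[≠] a, z ∉ T := by
      have : ((T : Set ℂ) \ {a})ᶜ ∈ 𝓝 a :=
        (T.finite_toSet.sdiff).isClosed.compl_mem_nhds (by simp)
      filter_upwards [nhdsWithin_le_nhds this, self_mem_nhdsWithin] with z hz hza hzT
      exact hz ⟨hzT, hza⟩
    have hball : ∀ᶠ z in 𝓝[≠] a, z ∈ Metric.ball (0 : ℂ) ρ :=
      nhdsWithin_le_nhds (Metric.isOpen_ball.mem_nhds ha)
    have he' := mem_codiscreteWithin_iff_forall_mem_nhdsNE.1 he a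
      (Metric.ball_subset_closedBall ha)
    filter_upwards [hTc, hball, he'] with z hzT hz hez
    refine ⟨hu0 z hz hzT, ?_, hz⟩
    rcases hez with hez | hez
    · have hez' : deriv f z = ((∏ᶠ a, (· - a) ^ D a) • h) z := hez
      rw [hez', Pi.smul_apply', smul_eq_mul, Function.FactorizedRational.finprod_eq_fun hfin]
      beta_reduce
      rw [finprod_eq_prod_of_mulSupport_subset (s := T), hu]
      · simp only [mul_pow, mul_inv, hgk z hz, inv_inv, ← Finset.prod_pow, ← Finset.prod_inv_distrib]
        congr 1
        refine Finset.prod_congr rfl fun b hb => ?_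
        rw [hDα', zpow_neg, zpow_natCast, mul_comm k, pow_mul]
      · intro b hb
        rw [hT, Finset.coe_union]
        refine Or.inl ?_
        rw [Set.Finite.coe_toFinset]
        intro hb0
        rw [Function.mem_mulSupport, hb0, zpow_zero] at hb
        exact hb rfl
    · exact absurd (Metric.ball_subset_closedBall hz) hez
  have hineq : ∀ᶠ z in 𝓝[≠] a, ‖iteratedDeriv k u z‖ ≤ |M| * ‖u z‖ := by
    filter_upwards [eventually_eventually_nhdsWithin.2 hgen, hgen, self_mem_nhdsWithin]
      with z hz1 hz2 hza
    have hz1' : ∀ᶠ w in 𝓝 z, u w ≠ 0 ∧ deriv f w = (u w ^ k)⁻¹ ∧ w ∈ Metric.ball 0 ρ := by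
      rwa [isOpen_compl_singleton.nhdsWithin_eq hza] at hz1
    have heq := schwarzianAux_eventuallyEq_of_deriv_eq_inv_pow hk (huan z hz2.2.2) hz2.1
      (hz1'.mono fun w hw => hw.2.1) (k - 1)
    rw [Nat.sub_add_cancel hk] at heq
    have han : AnalyticAt ℂ (genSchwarzian k f) z := by
      refine AnalyticAt.congr ?_ heq.symm
      exact (analyticAt_const.mul (analyticAt_iteratedDeriv (huan z hz2.2.2) k)).div
        (huan z hz2.2.2) hz2.1
    have hzD : z ∈ unitDisk := hsub (Metric.ball_subset_closedBall hz2.2.2)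
    have hb := hS z hzD
    rw [extModulus, if_neg (not_lt.2 (hord0 z hzD)),
      toMeromorphicNFAt_eq_self.2 han.meromorphicNFAt, EReal.coe_le_coe_iff] at hb
    have hval : genSchwarzian k f z = -k * iteratedDeriv k u z / u z := heq.self_of_nhds
    rw [hval, norm_div, norm_mul, norm_neg, Complex.norm_natCast,
      div_le_iff₀ (norm_pos_iff.2 hz2.1)] at hb
    have hk1 : (1 : ℝ) ≤ k := by exact_mod_cast hk
    calc ‖iteratedDeriv k u z‖ ≤ k * ‖iteratedDeriv k u z‖ :=
          le_mul_of_one_le_left (norm_nonneg _) hk1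
      _ ≤ M * ‖u z‖ := hb
      _ ≤ |M| * ‖u z‖ := mul_le_mul_of_nonneg_right (le_abs_self M) (norm_nonneg _)
  exact le_of_tendsto_of_tendsto
    ((analyticAt_iteratedDeriv (huan a ha) k).continuousAt.norm.tendsto.mono_left
      nhdsWithin_le_nhds)
    (((huan a ha).continuousAt.norm.tendsto.const_mul |M|).mono_left nhdsWithin_le_nhds) hineq

/-- The bound sees only `k` and the cover. The radii `ρ₁ < ρ` and the bound `B` depend on `s` or
`f`, but `B` merely starts the contraction. -/
theorem sum_poleMult_deriv_le {f : ℂ → ℂ} {k : ℕ} (hk : 1 ≤ k) {M r : ℝ}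
    (hrM : (2 * r) ^ k * |M| < 1) {t : Finset ℂ}
    (ht : Metric.closedBall (0 : ℂ) 1 ⊆ ⋃ c ∈ t, Metric.ball c r)
    (hf : MeromorphicOn f unitDisk) (htop : ∀ a ∈ unitDisk, meromorphicOrderAt (deriv f) a ≠ ⊤)
    (hS : ∀ a ∈ unitDisk, extModulus (genSchwarzian k f) a ≤ M)
    (s : Finset ℂ) (hs : ∀ a ∈ s, a ∈ unitDisk) :
    ∑ a ∈ s, poleMult (deriv f) a ≤ k * (t.card * k) := by
  classical
  obtain ⟨ρ₁, hρ₁, hρ₁1, hsρ⟩ : ∃ ρ₁ : ℝ, 0 < ρ₁ ∧ ρ₁ < 1 ∧ ∀ a ∈ s, a ∈ Metric.ball 0 ρ₁ := by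
    obtain ⟨ρ₁, ⟨h0, h1⟩, h2⟩ : ∃ ρ₁ ∈ Set.Ioo (0 : ℝ) 1, ∀ a ∈ s, ‖a‖ < ρ₁ := by
      have hev : ∀ᶠ x in 𝓝[<] (1 : ℝ), ∀ a ∈ s, ‖a‖ < x := by
        rw [Filter.eventually_all_finset]
        intro a ha
        have : ‖a‖ < 1 := by simpa [unitDisk] using hs a ha
        exact nhdsWithin_le_nhds (lt_mem_nhds this)
      exact (Filter.Eventually.and (Ioo_mem_nhdsLT (zero_lt_one' ℝ)) hev).exists
    exact ⟨ρ₁, h0, h1, fun a ha => by simpa using h2 a ha⟩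
  obtain ⟨ρ, hρ₁ρ, hρ1⟩ := exists_between hρ₁1
  obtain ⟨α, T, g, u, hsT, hord, hg, hg0, hu, hode⟩ :=
    exists_analytic_inv_root_deriv hk hf htop hS (hρ₁.trans hρ₁ρ) hρ1 s
  have hsub : Metric.ball (0 : ℂ) ρ₁ ⊆ Metric.ball 0 ρ := Metric.ball_subset_ball hρ₁ρ.le
  have huan : AnalyticOnNhd ℂ u (Metric.ball 0 ρ) := by
    rw [hu]
    exact fun z hz => (Finset.analyticAt_fun_prod _ fun a _ => by fun_prop).mul (hg z hz)
  obtain ⟨B, hB⟩ := (isCompact_closedBall (0 : ℂ) ρ₁).exists_bound_of_continuousOn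
    (huan.continuousOn.mono (Metric.closedBall_subset_ball hρ₁ρ))
  have hmult : ∀ a ∈ s, poleMult (deriv f) a = k * α a := by
    intro a ha
    rw [poleMult, hord a (hsub (hsρ a ha)), WithTop.untop₀_coe]
    omega
  have hloc : ∀ c, ∑ a ∈ s.filter (· ∈ Metric.ball c r), α a ≤ k := by
    intro c
    have hKsub : Metric.ball c r ∩ Metric.ball (0 : ℂ) ρ₁ ⊆ Metric.ball 0 ρ :=
      fun z hz => hsub hz.2
    refine (sum_multiplicity_lt (K := Metric.ball c r ∩ Metric.ball 0 ρ₁) (d := 2 * r) (B := B)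
      (Metric.isOpen_ball.inter Metric.isOpen_ball)
      ((convex_ball c r).inter (convex_ball 0 ρ₁)) ?_ hk (abs_nonneg M) hrM
      ((Finset.filter_subset _ s).trans hsT) ?_ α (hg.mono hKsub) (fun z hz => hg0 z (hKsub hz)) hu
      (fun z hz => hB z (Metric.ball_subset_closedBall hz.2))
      (fun z hz => hode z (hKsub hz))).le
    · intro z hz w hw
      rw [← dist_eq_norm]
      have h1 : dist z c < r := hz.1
      have h2 : dist w c < r := hw.1
      linarith [dist_triangle_right z w c]
    · intro a ha
      rw [Finset.mem_filter] at ha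
      exact ⟨ha.2, hsρ a ha.1⟩
  rw [Finset.sum_congr rfl hmult, ← Finset.mul_sum]
  refine Nat.mul_le_mul_left k ?_
  calc ∑ a ∈ s, α a ≤ ∑ a ∈ s, ∑ c ∈ t, if a ∈ Metric.ball c r then α a else 0 := by
        refine Finset.sum_le_sum fun a ha => ?_
        obtain ⟨c, hc, hac⟩ := Set.mem_iUnion₂.1 (ht (Metric.ball_subset_closedBall (hs a ha)))
        have := Finset.single_le_sum (f := fun c => if a ∈ Metric.ball c r then α a else 0)
          (fun _ _ => Nat.zero_le _) hc
        simpa only [if_pos hac] using this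
    _ = ∑ c ∈ t, ∑ a ∈ s.filter (· ∈ Metric.ball c r), α a := by
        rw [Finset.sum_comm]
        simp only [Finset.sum_filter]
    _ ≤ t.card * k := by
        simpa using Finset.sum_le_card_nsmul t _ k fun c _ => hloc c

theorem mainTheorem6 (k : ℕ) (hk : 1 ≤ k) (M : ℝ) :
    ∃ N : ℕ, ∀ f ∈ GenSchwarz.boundedSchwarzianFamily k M,
      GenSchwarz.poleCount f ≤ (N : ℕ∞) ∧ GenSchwarz.poleCount (deriv f) ≤ (N : ℕ∞) := by
  -- Both `r` and the cover `t` are fixed before `f`, which makes the bound uniform.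
  obtain ⟨r, hr, hrM⟩ : ∃ r : ℝ, 0 < r ∧ (2 * r) ^ k * |M| < 1 := by
    have ht : Tendsto (fun r : ℝ => (2 * r) ^ k * |M|) (𝓝[>] 0) (𝓝 0) := by
      have hc : Continuous fun r : ℝ => (2 * r) ^ k * |M| := by fun_prop
      have := hc.tendsto 0
      rw [mul_zero, zero_pow (by omega), zero_mul] at this
      exact this.mono_left nhdsWithin_le_nhds
    exact (Filter.Eventually.and (self_mem_nhdsWithin (s := Set.Ioi (0 : ℝ))) 
      (ht.eventually_lt_const zero_lt_one)).exists
  obtain ⟨t, -, ht⟩ := (isCompact_closedBall (0 : ℂ) 1).elim_nhds_subcover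
    (fun c => Metric.ball c r) (fun c _ => Metric.ball_mem_nhds c hr)
  refine ⟨k * (t.card * k), fun f hf => ?_⟩
  obtain ⟨hmer, hsup⟩ := hf
  have hc : ¬ IsConstOnDisk f := by
    intro hc
    rw [schwarzianSup, if_pos hc, top_le_iff] at hsup
    exact EReal.coe_ne_top M hsup
  rw [schwarzianSup, if_neg hc] at hsup
  have hS : ∀ a ∈ unitDisk, extModulus (genSchwarzian k f) a ≤ M := fun a ha =>
    (le_iSup₂ (f := fun z (_ : z ∈ unitDisk) => extModulus (genSchwarzian k f) z) a ha).trans hsup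
  have hderiv : poleCount (deriv f) ≤ ((k * (t.card * k) : ℕ) : ℕ∞) := by
    refine iSup_le fun s => Nat.cast_le.2 ?_
    have := sum_poleMult_deriv_le hk hrM ht hmer
      (fun a ha => meromorphicOrderAt_deriv_ne_top_of_not_isConst hmer hc ha) hS
      (s.map (Function.Embedding.subtype _)) (by
        intro a ha
        obtain ⟨b, -, rfl⟩ := Finset.mem_map.1 ha
        exact b.2)
    simpa [Finset.sum_map] using this
  refine ⟨le_trans (iSup_mono fun s => Nat.cast_le.2 ?_) hderiv, hderiv⟩
  exact Finset.sum_le_sum fun z _ => poleMult_le_poleMult_deriv
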